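/- For $i\in\mathbb N_0=\{0,1,2,\dots\}$ let $P_i(z)=\frac{2^{-i}}{i!}\frac{d^i}{dz^i}(z^2-1)^i$ be the classical Legendre polynomials, and put $R_{ij}(z)=\int_{-1}^zP_i(u)P_j(u)\,du$. For $\boldsymbol m=(m_1,\dots,m_n)\in\mathbb N_0^n$ and $\boldsymbol t_{\boldsymbol m}=(t_{m_1},\dots,t_{m_n})\in\mathbb R^n$ let $\mathcal R_{\boldsymbol m}(z;\boldsymbol t_{\boldsymbol m})$ be the $n\times n$ matrix with entries $\delta_{k\ell}+t_{m_\ell}R_{m_km_\ell}(z)$, let $$\tau_{\boldsymbol m}(z;\boldsymbol t_{\boldsymbol m})=\det\mathcal R_{\boldsymbol m}(z;\boldsymbol t_{\boldsymbol m}),\qquad \boldsymbol Q_{\boldsymbol m}^{\rm T}=\tau_{\boldsymbol m}\,\mathcal R_{\boldsymbol m}^{-1}\,(P_{m_1},\dots,P_{m_n})^{\rm T},$$ and for $i\in\mathbb N_0$ let the polynomial $P_{\boldsymbol m;i}(z;\boldsymbol t_{\boldsymbol m})$ be the last entry of $\boldsymbol Q_{(\boldsymbol m,i)}(z;\boldsymbol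 t_{(\boldsymbol m,i)})$, where $(\boldsymbol m,i)=(m_1,\dots,m_n,i)$ and $\boldsymbol t_{(\boldsymbol m,i)}=(\boldsymbol t_{\boldsymbol m},t_i)$; it does not depend on the extra parameter $t_i$. If $\tau$ is a real polynomial without zeros on $[-1,1]$, a sequence $(\hat P_i)_{i\in\mathbb N_0}$ of real polynomials is called a family of exceptional Legendre polynomials (with weight $\tau^{-2}$) if 1. each $\hat P_i$ is, for some constant $\lambda_i\in\mathbb R$, an eigenfunction of the Sturm–Liouville problem on $[-1,1]$ $$\Big(\frac{1-z^2}{\tau^2}\,y'\Big)'+\frac{(1-z^2)\,\tau''}{\tau^3}\,y=\frac{\lambda_i}{\tau^2}\,y,\qquad \frac{1-z^2}{\tau^2}\,y'\to0\ \text{ as } z\to\pm1$$ (equivalently, $\hat T(\tau)y=\lambda_iy$ with these boundary conditions, where $\hat T(\tau)y=(1-z^2)\big(y''-2\frac{\tau'}{\tau}y'+\frac{\tau''}{\tau}y\big)-2zy'$); 2. all but finitely many positive integers occur among the degrees $\deg\hat P_i$; 3. $\int_{-1}^1\hat P_i\hat P_j\,\tau^{-2}\,dz=0$ for $i\ne j$;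 4. $\{\hat P_i\}_{i\in\mathbb N_0}$ is complete (its linear span is dense) in $L^2([-1,1],\tau^{-2}dz)$. **Theorem.** Let $\boldsymbol m\in\mathbb N_0^n$ with $m_1,\dots,m_n$ distinct, and let $\boldsymbol t_{\boldsymbol m}\in\mathbb R^n$. The polynomial $\tau_{\boldsymbol m}(z;\boldsymbol t_{\boldsymbol m})$ has no zeros on $[-1,1]$ if and only if $t_{m_j}>-m_j-\frac12$ for all $j\in\{1,\dots,n\}$. If these conditions hold, then $\{P_{\boldsymbol m;i}(z;\boldsymbol t_{\boldsymbol m})\}_{i\in\mathbb N_0}$ is a family of exceptional Legendre polynomials with weight $\tau_{\boldsymbol m}^{-2}$ (in particular, it is complete in $L^2([-1,1],\tau_{\boldsymbol m}^{-2}dz)$), and for all $i_1,i_2\in\mathbb N_0$ $$\int_{-1}^1\frac{P_{\boldsymbol m;i_1}(u;\boldsymbol t_{\boldsymbol m})\,P_{\boldsymbol m;i_2}(u;\boldsymbol t_{\boldsymbol m})}{\tau_{\boldsymbol m}(u;\boldsymbol t_{\boldsymbol m})^2}\,du=\frac{2}{1+2i_1+2\sum_{j=1}^n\delta_{i_1m_j}\,t_{m_j}}\,\delta_{i_1i_2}.$$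 -/

import Mathlib

open Polynomial MeasureTheory Filter Topology

noncomputable section

namespace ExcLegendre

/-- The classical Legendre polynomial `P_i = 2^{-i} / i! * D^i (z^2 - 1)^i`. -/
def legendreP (i : ℕ) : ℝ[X] :=
  C (1 / (2 ^ i * (i.factorial : ℝ))) * derivative^[i] ((X ^ 2 - 1) ^ i)

/-- The polynomial antiderivative of `p` without constant term. -/
def antideriv (p : ℝ[X]) : ℝ[X] :=
  p.sum fun k a => monomial (k + 1) (a / (k + 1))

/-- `R_{ij}(z) = ∫_{-1}^z P_i(u) P_j(u) du`, as a polynomial in `z`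
(see `eval_R` for the integral formula). -/
def R (i j : ℕ) : ℝ[X] :=
  antideriv (legendreP i * legendreP j) - C ((antideriv (legendreP i * legendreP j)).eval (-1))

/-- The matrix `δ_{kl} + t_{m_l} R_{m_k m_l}(z)`; here `t l` is the parameter `t_{m_l}`. -/
def matR {n : ℕ} (m : Fin n → ℕ) (t : Fin n → ℝ) : Matrix (Fin n) (Fin n) ℝ[X] :=
  Matrix.of fun k l => (if k = l then 1 else 0) + C (t l) * R (m k) (m l)

/-- `τ_m(z; t_m)`, the determinant of `matR m t`. -/
def tau {n : ℕ} (m : Fin n → ℕ) (t : Fin n → ℝ) : ℝ[X] := (matR m t).det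

/-- The tuple `Q_m = τ_m R_m⁻¹ (P_{m_1}, …, P_{m_n})ᵀ`. The polynomial matrix `τ_m R_m⁻¹` is the
adjugate of `R_m`; `map_Q` is the formula with the inverse, over the field of rational functions. -/
def Q {n : ℕ} (m : Fin n → ℕ) (t : Fin n → ℝ) : Fin n → ℝ[X] :=
  Matrix.mulVec (matR m t).adjugate fun k => legendreP (m k)

/-- `P_{m;i}(z; t_m)`, the last entry of `Q_{(m,i)}(z; t_{(m,i)})`. It does not depend on the
parameter `t_i` attached to the last index (see `P_eq`), which is set to `0` here. -/
def P {n : ℕ} (m : Fin n → ℕ) (t : Fin n → ℝ) (i : ℕ) : ℝ[X] :=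
  Q (Fin.snoc m i : Fin (n + 1) → ℕ) (Fin.snoc t 0 : Fin (n + 1) → ℝ) (Fin.last n)

/-- `y` is an eigenfunction, with eigenvalue `lam`, of the Sturm–Liouville problem
`(p y')' + q y = lam w y` on `(a, b)` with boundary conditions `p y' → 0` at `a` and at `b`. -/
structure IsSturmLiouvilleEigenfunction (a b : ℝ) (p q w : ℝ → ℝ) (lam : ℝ) (y : ℝ → ℝ) :
    Prop where
  ne_zero : ∃ z ∈ Set.Ioo a b, y z ≠ 0
  differentiable : ∀ z ∈ Set.Ioo a b, DifferentiableAt ℝ y z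
  differentiable_quasi : ∀ z ∈ Set.Ioo a b, DifferentiableAt ℝ (fun x => p x * deriv y x) z
  equation : ∀ z ∈ Set.Ioo a b,
    deriv (fun x => p x * deriv y x) z + q z * y z = lam * w z * y z
  boundary_left : Tendsto (fun x => p x * deriv y x) (𝓝[>] a) (𝓝 0)
  boundary_right : Tendsto (fun x => p x * deriv y x) (𝓝[<] b) (𝓝 0)

/-- The operator
`T̂(τ) y = (1 - z²) (y'' - 2 (τ'/τ) y' + (τ''/τ) y) - 2 z y'`. -/
def excOp (τ y : ℝ[X]) (z : ℝ) : ℝ :=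
  (1 - z ^ 2) * ((derivative (derivative y)).eval z
      - 2 * ((derivative τ).eval z / τ.eval z) * (derivative y).eval z
      + (derivative (derivative τ)).eval z / τ.eval z * y.eval z)
    - 2 * z * (derivative y).eval z

/-- Leading coefficient of the Sturm–Liouville form of `T̂(τ)`. -/
def slP (τ : ℝ[X]) (z : ℝ) : ℝ := (1 - z ^ 2) / τ.eval z ^ 2

/-- Potential of the Sturm–Liouville form of `T̂(τ)`. -/
def slQ (τ : ℝ[X]) (z : ℝ) : ℝ :=
  (1 - z ^ 2) * (derivative (derivative τ)).eval z / τ.eval z ^ 3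

/-- The weight `τ^{-2}`. -/
def weight (τ : ℝ[X]) (z : ℝ) : ℝ := 1 / τ.eval z ^ 2

/-- The measure `τ^{-2} dz` on `[-1, 1]`. -/
def weightMeasure (τ : ℝ[X]) : Measure ℝ :=
  (volume.restrict (Set.Icc (-1) 1)).withDensity fun z => ENNReal.ofReal (weight τ z)

/-- `(p_i)` is a family of exceptional Legendre polynomials with weight `τ^{-2}`. -/
structure IsExceptionalLegendreFamily (τ : ℝ[X]) (p : ℕ → ℝ[X]) : Prop where
  tau_ne_zero : ∀ z ∈ Set.Icc (-1 : ℝ) 1, τ.eval z ≠ 0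
  /-- The `p_i` are eigenfunctions of the Sturm–Liouville problem of `T̂(τ)` on `[-1, 1]`. -/
  eigenfunctions : ∃ lam : ℕ → ℝ, ∀ i, IsSturmLiouvilleEigenfunction (-1) 1
    (slP τ) (slQ τ) (weight τ) (lam i) (fun z => (p i).eval z)
  /-- All but finitely many positive integers are degrees. -/
  degrees : {d : ℕ | 0 < d ∧ ∀ i, (p i).natDegree ≠ d}.Finite
  orthogonal : ∀ i j, i ≠ j →
    ∫ z in (-1 : ℝ)..1, (p i).eval z * (p j).eval z / τ.eval z ^ 2 = 0
  /-- The `p_i` lie in `L²([-1,1], τ^{-2} dz)` and their linear span is dense there. -/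
  complete : ∃ h : ∀ i, MemLp (fun z => (p i).eval z) 2 (weightMeasure τ),
    (Submodule.span ℝ (Set.range fun i => (h i).toLp (fun z => (p i).eval z))).topologicalClosure
      = ⊤

/-! Facts showing that the definitions above are the intended ones. -/

theorem derivative_antideriv (p : ℝ[X]) : derivative (antideriv p) = p := by
  unfold antideriv
  rw [Polynomial.sum, derivative_sum]
  conv_rhs => rw [p.as_sum_support]
  refine Finset.sum_congr rfl fun k _ => ?_
  rw [derivative_monomial]
  have : ((k : ℝ) + 1) ≠ 0 := by positivity
  simp [this]

theorem eval_R (i j : ℕ) (z : ℝ) :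
    (R i j).eval z = ∫ u in (-1 : ℝ)..z, (legendreP i).eval u * (legendreP j).eval u := by
  have h : ∀ u : ℝ, HasDerivAt (fun x => (antideriv (legendreP i * legendreP j)).eval x)
      ((legendreP i).eval u * (legendreP j).eval u) u := by
    intro u
    have := (antideriv (legendreP i * legendreP j)).hasDerivAt u
    rwa [derivative_antideriv, eval_mul] at this
  rw [intervalIntegral.integral_eq_sub_of_hasDerivAt (fun u _ => h u)
    (Continuous.intervalIntegrable (by fun_prop) _ _)]
  simp [R]

theorem tau_eval_neg_one {n : ℕ} (m : Fin n → ℕ) (t : Fin n → ℝ) : (tau m t).eval (-1) = 1 := by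
  have h : (evalRingHom (-1 : ℝ)).mapMatrix (matR m t) = 1 := by
    ext k l
    simp only [RingHom.mapMatrix_apply, Matrix.map_apply, matR, Matrix.of_apply, R,
      coe_evalRingHom, eval_add, eval_mul, eval_sub, eval_C, sub_self, mul_zero, add_zero,
      Matrix.one_apply]
    split_ifs <;> simp
  have h2 := RingHom.map_det (evalRingHom (-1 : ℝ)) (matR m t)
  rw [h, Matrix.det_one] at h2
  exact h2

theorem map_Q {n : ℕ} (m : Fin n → ℕ) (t : Fin n → ℝ) :
    (fun k => algebraMap ℝ[X] (RatFunc ℝ) (Q m t k)) =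
      algebraMap ℝ[X] (RatFunc ℝ) (tau m t) •
        Matrix.mulVec ((matR m t).map (algebraMap ℝ[X] (RatFunc ℝ)))⁻¹
          (fun k => algebraMap ℝ[X] (RatFunc ℝ) (legendreP (m k))) := by
  set f := algebraMap ℝ[X] (RatFunc ℝ) with hf
  have h0 : f (tau m t) ≠ 0 := by
    intro h
    have h1 : tau m t = 0 := (map_eq_zero_iff f (RatFunc.algebraMap_injective ℝ)).1 h
    have := tau_eval_neg_one m t
    simp [h1] at this
  have hdet : ((matR m t).map f).det = f (tau m t) := (RingHom.map_det f (matR m t)).symm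
  have hadj : ((matR m t).map f).adjugate = (matR m t).adjugate.map f :=
    (RingHom.map_adjugate f (matR m t)).symm
  rw [Matrix.inv_def, hdet, hadj, Ring.inverse_eq_inv', Matrix.smul_mulVec, smul_smul,
    mul_inv_cancel₀ h0, one_smul]
  ext k
  exact RingHom.map_mulVec f _ _ k

theorem P_eq {n : ℕ} (m : Fin n → ℕ) (t : Fin n → ℝ) (i : ℕ) (s : ℝ) :
    Q (Fin.snoc m i : Fin (n + 1) → ℕ) (Fin.snoc t s : Fin (n + 1) → ℝ) (Fin.last n) = P m t i := by
  unfold P Q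
  rw [← Matrix.cramer_eq_adjugate_mulVec, ← Matrix.cramer_eq_adjugate_mulVec,
    Matrix.cramer_apply, Matrix.cramer_apply]
  congr 1
  ext1 k l
  induction l using Fin.lastCases with
  | last => simp
  | cast l => simp [matR, (Fin.castSucc_lt_last l).ne]

/-- The Sturm–Liouville form of `T̂(τ)`. -/
theorem sturmLiouville_form (τ y : ℝ[X]) (z : ℝ) (h : τ.eval z ≠ 0) :
    deriv (fun x => slP τ x * deriv (fun u => y.eval u) x) z + slQ τ z * y.eval z
      = weight τ z * excOp τ y z := by
  have h1 : deriv (fun u => y.eval u) = fun x => (derivative y).eval x := by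
    ext x; exact y.deriv
  have h2 : HasDerivAt (fun x : ℝ => 1 - x ^ 2) (-(2 * z)) z := by
    simpa using (hasDerivAt_pow 2 z).const_sub 1
  have h3 := (h2.div ((τ.hasDerivAt z).pow 2) (pow_ne_zero 2 h)).mul
    ((derivative y).hasDerivAt z)
  have h4 := h3.deriv
  rw [h1]
  change deriv (fun x => slP τ x * (derivative y).eval x) z = _ at h4
  rw [h4]
  simp only [slQ, weight, excOp, Pi.pow_apply, Pi.div_apply]
  field_simp
  ring

end ExcLegendre

end

noncomputable section

namespace ExcLegendre

/-! ### Classical Legendre polynomials -/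

/-! Let `p` be the column of the `P_{m_k}`, `G(z)` their Gram matrix on `[-1,z]` and `T = diag(t)`.
Then `M = matR m t = 1 + G T` has the rank-one derivative `M' = p pᵀ T`, and `T M` is symmetric.
Differentiating `M Q = τ p`, and using the Wronskian formula for `R` to commute `M` with the
diagonal matrix of Legendre eigenvalues, gives the differential equation (`Q_ode`). All these are
polynomial identities, valid whether or not `τ` vanishes somewhere.

The same calculus shows that `R_{ij} - τ⁻¹ ∑ t_l R_{i m_l} intQ_l` is an antiderivative of `P_{m;i}
P_{m;j} / τ²`. It vanishes at `-1`, and at `1` the matrix `M` is diagonal by orthogonality, so the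
integrals are explicit (`integral_P_mul_P`). If `τ` has no zeros, nonnegativity of these integrals
forces the bounds on `t`. Conversely, a kernel vector of `M(z)` produces a combination `f` of the
`P_{m_k}` that contradicts Bessel's inequality on `[-1,z]` (`tau_eval_ne_zero`).

Degrees follow from the top coefficient of the differential equation. For completeness, the map `g ↦
τ g - ∑ t_l Q_l ∫_{-1}^z P_{m_l} g` takes `P_i` to `P_{m;i}`, is bounded in the sup norm, and is
onto `C([-1,1])` by an explicit inverse (`exists_continuous_preimage`). Weierstrass approximation
then passes to the `P_{m;i}`. -/

theorem iterate_derivative_ode (n k : ℕ) :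
    (X ^ 2 - 1 : ℝ[X]) * derivative^[k + 2] ((X ^ 2 - 1) ^ n)
      + 2 * ((k : ℝ[X]) + 1 - (n : ℝ[X])) * X * derivative^[k + 1] ((X ^ 2 - 1) ^ n)
      + (((k : ℝ[X]) + 1) * (k : ℝ[X]) - 2 * (n : ℝ[X]) * ((k : ℝ[X]) + 1)) * derivative^[k] ((X ^ 2 - 1) ^ n) = 0 := by
  induction k with
  | zero =>
    -- The first-order equation of `v = (X² - 1)ⁿ`; its derivative is the case `k = 0`, and each
    -- further derivative raises `k` by one.
    have h : (X ^ 2 - 1 : ℝ[X]) * derivative ((X ^ 2 - 1) ^ n)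
        - 2 * (n : ℝ[X]) * X * (X ^ 2 - 1) ^ n = 0 := by
      cases n with
      | zero => simp
      | succ n =>
        rw [derivative_pow]
        simp
        ring
    have h2 := congrArg derivative h
    simp only [Function.iterate_succ, Function.iterate_zero, Function.comp, id]
    simp only [derivative_sub, derivative_mul, derivative_X_pow, derivative_one, derivative_X,
      derivative_natCast, derivative_ofNat, derivative_zero] at h2
    simp at h2 ⊢
    simp only [map_ofNat] at h2
    linear_combination h2
  | succ k ih =>
    have h2 := congrArg derivative ih
    simp only [derivative_add, derivative_sub, derivative_mul, derivative_X_pow, derivative_one,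
      derivative_X, derivative_natCast, derivative_ofNat, derivative_zero,
      ← Function.iterate_succ_apply' derivative] at h2
    simp at h2 ⊢
    simp only [map_ofNat] at h2
    linear_combination h2

/-- The Legendre differential equation. -/
theorem legendreP_ode (i : ℕ) :
    (1 - X ^ 2) * derivative (derivative (legendreP i)) - 2 * X * derivative (legendreP i)
      = C (-((i : ℝ) * (i + 1))) * legendreP i := by
  have h := iterate_derivative_ode i i
  simp only [legendreP, derivative_C_mul, ← Function.iterate_succ_apply' derivative]
  simp only [map_neg, map_mul, map_add, map_one, map_natCast]
  linear_combination (-C (1 / (2 ^ i * (i.factorial : ℝ)))) * h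

/-- The value is `n!` times the `n`-th Taylor coefficient at `a`, and the factor `(X - a)ⁿ` shifts
that coefficient to the constant term of `q`. -/
theorem eval_iterate_derivative_X_sub_C_pow_mul (n : ℕ) (a : ℝ) (q : ℝ[X]) :
    (derivative^[n] ((X - C a) ^ n * q)).eval a = n.factorial * q.eval a := by
  rw [← factorial_smul_hasseDeriv]
  rw [LinearMap.smul_apply, eval_smul, nsmul_eq_mul, ← taylor_coeff, taylor_mul, taylor_pow]
  simp [coeff_X_pow_mul', taylor_coeff_zero]

theorem legendreP_eval_one (i : ℕ) : (legendreP i).eval 1 = 1 := by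
  have h : (X ^ 2 - 1 : ℝ[X]) ^ i = (X - C 1) ^ i * (X + 1) ^ i := by
    rw [← mul_pow]; congr 1; simp; ring
  rw [legendreP, h, eval_mul, eval_iterate_derivative_X_sub_C_pow_mul]
  have := i.factorial_pos
  simp
  norm_num
  field_simp

/-- The sign of `P_i(-1)` is irrelevant: only its square enters the boundary term in
`R_self_eval_one`. -/
theorem legendreP_eval_neg_one_sq (i : ℕ) : (legendreP i).eval (-1) ^ 2 = 1 := by
  have h : (X ^ 2 - 1 : ℝ[X]) ^ i = (X - C (-1)) ^ i * (X - 1) ^ i := by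
    rw [← mul_pow]; congr 1; simp; ring
  rw [legendreP, h, eval_mul, eval_iterate_derivative_X_sub_C_pow_mul]
  have := i.factorial_pos
  have h2 : ((-1 - 1 : ℝ)) ^ i = (-1) ^ i * 2 ^ i := by rw [← mul_pow]; norm_num
  simp only [eval_C, eval_pow, eval_sub, eval_X, eval_one, h2]
  field_simp
  rw [← pow_mul, mul_comm, pow_mul]; simp

theorem natDegree_legendreP (i : ℕ) : (legendreP i).natDegree = i := by
  have hv : (X ^ 2 - 1 : ℝ[X]).Monic := by
    have := monic_X_pow_sub_C (1 : ℝ) (n := 2) two_ne_zero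
    simpa using this
  have hd : (X ^ 2 - 1 : ℝ[X]).natDegree = 2 := by
    have := natDegree_X_pow_sub_C (R := ℝ) (n := 2) (r := 1)
    simpa using this
  have hdeg : ((X ^ 2 - 1 : ℝ[X]) ^ i).natDegree = i + i := by
    rw [hv.natDegree_pow, hd]; ring
  apply natDegree_eq_of_le_of_coeff_ne_zero
  · refine (natDegree_C_mul_le _ _).trans ((natDegree_iterate_derivative _ _).trans ?_)
    omega
  · rw [legendreP, coeff_C_mul, coeff_iterate_derivative]
    have h1 : ((X ^ 2 - 1 : ℝ[X]) ^ i).coeff (i + i) = 1 := by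
      rw [← hdeg]; exact (hv.pow i).coeff_natDegree
    rw [h1]
    have := i.factorial_pos
    have h3 : (i + i).descFactorial i ≠ 0 := by
      rw [Ne, Nat.descFactorial_eq_zero_iff_lt]; omega
    simp only [nsmul_eq_mul, mul_one]
    refine mul_ne_zero (by positivity) (by exact_mod_cast h3)

theorem legendreP_ne_zero (i : ℕ) : legendreP i ≠ 0 := by
  intro h
  have := legendreP_eval_one i
  simp [h] at this

theorem mem_span_legendreP (n : ℕ) (g : ℝ[X]) (hg : g.natDegree < n) :
    g ∈ Submodule.span ℝ (legendreP '' Set.Iio n) := by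
  induction n generalizing g with
  | zero => omega
  | succ n ih =>
    have hlc : (legendreP n).coeff n ≠ 0 := by
      have := leadingCoeff_ne_zero.2 (legendreP_ne_zero n)
      rwa [leadingCoeff, natDegree_legendreP] at this
    set c := g.coeff n / (legendreP n).coeff n with hc
    have hmem : legendreP n ∈ Submodule.span ℝ (legendreP '' Set.Iio (n + 1)) :=
      Submodule.subset_span ⟨n, by simp, rfl⟩
    have hle : (g - c • legendreP n).natDegree ≤ n := by
      refine (natDegree_sub_le _ _).trans (max_le (by omega) ?_)
      exact (natDegree_smul_le _ _).trans (natDegree_legendreP n).le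
    have hco : (g - c • legendreP n).coeff n = 0 := by
      rw [coeff_sub, coeff_smul, smul_eq_mul, hc]; field_simp; simp
    have key : g - c • legendreP n ∈ Submodule.span ℝ (legendreP '' Set.Iio (n + 1)) := by
      by_cases h0 : g - c • legendreP n = 0
      · rw [h0]; exact Submodule.zero_mem _
      · have hlt : (g - c • legendreP n).natDegree < n := by
          refine lt_of_le_of_ne hle fun h => ?_
          have := leadingCoeff_ne_zero.2 h0
          rw [leadingCoeff, h] at this
          exact this hco
        exact Submodule.span_mono (Set.image_mono (Set.Iio_subset_Iio (by omega))) (ih _ hlt)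
    have := Submodule.add_mem _ key (Submodule.smul_mem _ c hmem)
    simpa using this

theorem derivative_R (i j : ℕ) : derivative (R i j) = legendreP i * legendreP j := by
  simp [R, derivative_antideriv]

theorem R_eval_neg_one (i j : ℕ) : (R i j).eval (-1) = 0 := by simp [R]

theorem R_comm (i j : ℕ) : R i j = R j i := by simp [R, mul_comm]

theorem eq_of_derivative_eq_of_eval_eq {p q : ℝ[X]} (a : ℝ) (hd : derivative p = derivative q)
    (he : p.eval a = q.eval a) : p = q := by
  have h : (p - q).natDegree = 0 := derivative_eq_zero.1 (by simp [hd])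
  obtain ⟨c, hc⟩ : ∃ c, p - q = C c := ⟨_, eq_C_of_natDegree_eq_zero h⟩
  have h2 := congrArg (eval a) hc
  rw [eval_sub, he, sub_self, eval_C] at h2
  rw [← h2, C_0] at hc
  exact sub_eq_zero.1 hc

/-- Wronskian formula for `R`. -/
theorem wronskian_R (i j : ℕ) :
    C ((i : ℝ) * (i + 1) - j * (j + 1)) * R i j
      = (1 - X ^ 2) * (legendreP i * derivative (legendreP j)
        - derivative (legendreP i) * legendreP j) := by
  -- The derivatives agree by the two Legendre equations, and `1 - X²` kills the right side at `-1`.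
  apply eq_of_derivative_eq_of_eval_eq (-1)
  · have h1 := legendreP_ode i
    have h2 := legendreP_ode j
    simp only [derivative_mul, derivative_C, derivative_R, derivative_sub, derivative_one,
      derivative_X_pow]
    simp only [map_neg, map_mul, map_add, map_one, map_sub, map_natCast] at h1 h2 ⊢
    simp
    linear_combination legendreP j * h1 - legendreP i * h2
  · simp [R_eval_neg_one]

/-- The right side of `wronskian_R` vanishes at `1`, while `i(i+1) - j(j+1) = (i-j)(i+j+1)` is
nonzero. -/
theorem R_eval_one_of_ne {i j : ℕ} (h : i ≠ j) : (R i j).eval 1 = 0 := by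
  have h1 := congrArg (eval 1) (wronskian_R i j)
  simp only [eval_mul, eval_C, eval_sub, eval_one, eval_pow, eval_X, one_pow, sub_self,
    zero_mul] at h1
  refine (mul_eq_zero.1 h1).resolve_left fun h0 => h ?_
  have h2 : ((i : ℝ) - j) * (i + j + 1) = 0 := by linear_combination h0
  rcases mul_eq_zero.1 h2 with h3 | h3
  · exact_mod_cast sub_eq_zero.1 h3
  · have : (0 : ℝ) < i + j + 1 := by positivity
    exact absurd h3 this.ne'

theorem integral_legendreP_mul_of_natDegree_lt (n : ℕ) (g : ℝ[X]) (hg : g.natDegree < n) :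
    ∫ u in (-1 : ℝ)..1, (legendreP n).eval u * g.eval u = 0 := by
  have h := mem_span_legendreP n g hg
  clear hg
  induction h using Submodule.span_induction with
  | mem x hx =>
    obtain ⟨k, hk, rfl⟩ := hx
    rw [← eval_R]
    exact R_eval_one_of_ne (ne_of_gt hk)
  | zero => simp
  | add x y _ _ hx hy =>
    simp only [eval_add, mul_add]
    rw [intervalIntegral.integral_add (Continuous.intervalIntegrable (by fun_prop) _ _)
      (Continuous.intervalIntegrable (by fun_prop) _ _), hx, hy, add_zero]
  | smul c x _ hx =>
    simp only [eval_smul, smul_eq_mul, mul_left_comm _ c]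
    rw [intervalIntegral.integral_const_mul, hx, mul_zero]

/-- Integrating `(X p²)' = p² + 2 p X p'` gives `2`. Since `X p' - n p` has degree below `n`, it is
orthogonal to `p`, so `(1 + 2n) ∫ p² = 2`. -/
theorem R_self_eval_one (n : ℕ) : (R n n).eval 1 = 2 / (2 * n + 1) := by
  set p := legendreP n with hp
  have hI : (R n n).eval 1 = ∫ u in (-1 : ℝ)..1, p.eval u * p.eval u := eval_R n n 1
  have h1 : ∫ u in (-1 : ℝ)..1, (p.eval u * p.eval u
      + 2 * (p.eval u * (X * derivative p).eval u)) = 2 := by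
    rw [intervalIntegral.integral_eq_sub_of_hasDerivAt (f := fun u => (X * p ^ 2).eval u)]
    · have e1 := legendreP_eval_one n
      have e2 := legendreP_eval_neg_one_sq n
      simp only [eval_mul, eval_X, eval_pow]
      rw [← hp] at e1 e2
      rw [e1, e2]; norm_num
    · intro u _
      have := (X * p ^ 2).hasDerivAt u
      have e : derivative (X * p ^ 2) = p * p + 2 * (p * (X * derivative p)) := by
        rw [derivative_mul, derivative_X, derivative_sq]
        simp only [map_ofNat]
        ring
      rw [e] at this
      simpa only [eval_add, eval_mul, eval_ofNat] using this
    · exact Continuous.intervalIntegrable (by fun_prop) _ _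
  have h2 : ∫ u in (-1 : ℝ)..1, p.eval u * (X * derivative p - C (n : ℝ) * p).eval u = 0 := by
    -- For `n = 0` no degree is below `n`, but then `X p' - n p` is zero.
    rcases Nat.eq_zero_or_pos n with h0 | h0
    · have : derivative p = 0 := derivative_of_natDegree_zero (by rw [hp, natDegree_legendreP, h0])
      simp [this, h0]
    · by_cases hz : X * derivative p - C (n : ℝ) * p = 0
      · rw [hz]; simp
      apply integral_legendreP_mul_of_natDegree_lt
      have hle : (X * derivative p - C (n : ℝ) * p).natDegree ≤ n := by
        refine (natDegree_sub_le _ _).trans (max_le ?_ ?_)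
        · have := natDegree_derivative_le p
          have e := natDegree_legendreP n
          rw [← hp] at e
          refine natDegree_mul_le.trans ?_
          rw [natDegree_X]
          omega
        · exact (natDegree_C_mul_le _ _).trans (natDegree_legendreP n).le
      refine lt_of_le_of_ne hle fun h => ?_
      have h3 := leadingCoeff_ne_zero.2 hz
      rw [leadingCoeff, h] at h3
      apply h3
      obtain ⟨k, hk⟩ : ∃ k, n = k + 1 := ⟨n - 1, by omega⟩
      rw [coeff_sub, coeff_C_mul, hk, coeff_X_mul, coeff_derivative]
      push_cast
      ring
  simp only [eval_sub, mul_sub, eval_mul, eval_C] at h2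
  rw [intervalIntegral.integral_add, intervalIntegral.integral_const_mul, ← hI] at h1
  · rw [intervalIntegral.integral_sub] at h2
    · simp only [mul_left_comm _ (n : ℝ)] at h2
      rw [intervalIntegral.integral_const_mul, ← hI] at h2
      simp only [eval_mul] at h1
      rw [eq_div_iff (by positivity)]
      linear_combination h1 - 2 * h2
    all_goals exact Continuous.intervalIntegrable (by fun_prop) _ _
  all_goals exact Continuous.intervalIntegrable (by fun_prop) _ _

theorem R_eval_one (i j : ℕ) : (R i j).eval 1 = if i = j then 2 / (2 * (i : ℝ) + 1) else 0 := by
  split_ifs with h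
  · subst h; exact R_self_eval_one i
  · exact R_eval_one_of_ne h

/-! ### Polynomial identities for `tau`, `Q` and `P` -/

/-- Jacobi's formula. -/
theorem derivative_det {n : ℕ} (M : Matrix (Fin n) (Fin n) ℝ[X]) :
    derivative M.det = ∑ i, M.cramer (fun k => derivative (M k i)) i := by
  simp only [Matrix.cramer_apply, Matrix.det_apply, derivative_sum]
  rw [Finset.sum_comm]
  refine Finset.sum_congr rfl fun σ _ => ?_
  rw [Units.smul_def, map_zsmul, derivative_prod_finset, Finset.smul_sum]
  refine Finset.sum_congr rfl fun i _ => ?_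
  rw [Units.smul_def, ← Finset.prod_erase_mul Finset.univ _ (Finset.mem_univ i)]
  congr 2
  · refine Finset.prod_congr rfl fun j hj => ?_
    rw [Matrix.updateCol_ne (Finset.ne_of_mem_erase hj)]
  · simp

section

variable {n : ℕ} (m : Fin n → ℕ) (t : Fin n → ℝ)

theorem matR_apply (k l : Fin n) :
    matR m t k l = (if k = l then 1 else 0) + C (t l) * R (m k) (m l) := rfl

theorem derivative_matR (k l : Fin n) :
    derivative (matR m t k l) = C (t l) * (legendreP (m k) * legendreP (m l)) := by
  rw [matR_apply, derivative_add, derivative_C_mul, derivative_R]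
  split_ifs <;> simp

theorem tau_ne_zero : tau m t ≠ 0 := by
  intro h
  have := tau_eval_neg_one m t
  simp [h] at this

/-- Cancellation of `M`, whose determinant is a nonzero polynomial. Identities for vectors built
from the adjugate are checked after multiplication by `M`, without dividing. -/
theorem eq_of_sum_matR_eq {v w : Fin n → ℝ[X]}
    (h : ∀ k, ∑ l, matR m t k l * v l = ∑ l, matR m t k l * w l) : v = w := by
  have : (matR m t).mulVec (v - w) = 0 := by
    ext1 k
    simp only [Matrix.mulVec, dotProduct, Pi.sub_apply, mul_sub, Finset.sum_sub_distrib, h k,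
      sub_self, Pi.zero_apply]
  exact sub_eq_zero.1 (Matrix.eq_zero_of_mulVec_eq_zero (tau_ne_zero m t) this)

theorem sum_matR_mul_adjugate (v : Fin n → ℝ[X]) (k : Fin n) :
    ∑ l, matR m t k l * (matR m t).adjugate.mulVec v l = tau m t * v k := by
  have : (matR m t).mulVec ((matR m t).adjugate.mulVec v) = tau m t • v := by
    rw [Matrix.mulVec_mulVec, Matrix.mul_adjugate, Matrix.smul_mulVec, Matrix.one_mulVec]
    rfl
  exact congrFun this k

theorem sum_matR_mul_Q (k : Fin n) :
    ∑ l, matR m t k l * Q m t l = tau m t * legendreP (m k) :=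
  sum_matR_mul_adjugate m t _ k

/-- In Jacobi's formula each differentiated column is a multiple of `p`, and `adj(M) p = Q`. -/
theorem derivative_tau :
    derivative (tau m t) = ∑ l, C (t l) * legendreP (m l) * Q m t l := by
  rw [tau, derivative_det]
  refine Finset.sum_congr rfl fun i _ => ?_
  have : (fun k => derivative (matR m t k i))
      = (C (t i) * legendreP (m i)) • fun k => legendreP (m k) := by
    ext1 k
    rw [derivative_matR, Pi.smul_apply, smul_eq_mul]
    ring
  rw [this, map_smul, Pi.smul_apply, smul_eq_mul, Matrix.cramer_eq_adjugate_mulVec, Q]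

/-- In the derivative of `M Q = τ p`, the term `M' Q = p (pᵀ T Q) = τ' p` cancels against the right
side. -/
theorem sum_matR_mul_derivative_Q (k : Fin n) :
    ∑ l, matR m t k l * derivative (Q m t l) = tau m t * derivative (legendreP (m k)) := by
  have h := congrArg derivative (sum_matR_mul_Q m t k)
  simp only [derivative_sum, derivative_mul, derivative_matR, Finset.sum_add_distrib] at h
  have h2 : ∑ l, C (t l) * (legendreP (m k) * legendreP (m l)) * Q m t l
      = legendreP (m k) * derivative (tau m t) := by
    rw [derivative_tau, Finset.mul_sum]
    exact Finset.sum_congr rfl fun l _ => by ring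
  rw [h2] at h
  linear_combination h

/-- The remaining sum `∑ t_l P'_{m_l} Q_l` also appears in `sum_matR_mul_eigenvalue_Q`; the two
cancel in `Q_ode`. -/
theorem sum_matR_mul_derivative_derivative_Q (k : Fin n) :
    ∑ l, matR m t k l * derivative (derivative (Q m t l))
      = derivative (tau m t) * derivative (legendreP (m k))
        + tau m t * derivative (derivative (legendreP (m k)))
        - legendreP (m k) * derivative (derivative (tau m t))
        + legendreP (m k) * ∑ l, C (t l) * derivative (legendreP (m l)) * Q m t l := by
  have h := congrArg derivative (sum_matR_mul_derivative_Q m t k)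
  simp only [derivative_sum, derivative_mul, derivative_matR, Finset.sum_add_distrib] at h
  have h2 : ∑ l, C (t l) * (legendreP (m k) * legendreP (m l)) * derivative (Q m t l)
      = legendreP (m k) * (derivative (derivative (tau m t))
        - ∑ l, C (t l) * derivative (legendreP (m l)) * Q m t l) := by
    rw [derivative_tau]
    simp only [derivative_sum, derivative_mul, derivative_C, zero_mul, zero_add,
      Finset.sum_add_distrib, add_sub_cancel_left]
    rw [Finset.mul_sum]
    exact Finset.sum_congr rfl fun l _ => by ring
  rw [h2] at h
  linear_combination h

/-- The eigenvalue `-i (i + 1)` of the Legendre operator. -/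
def legendreEigenvalue (i : ℕ) : ℝ := -((i : ℝ) * (i + 1))

/-- By `wronskian_R` the commutator of `M` with the diagonal matrix of eigenvalues has entries `t_l
(1 - X²)` times Wronskians. -/
theorem sum_matR_mul_eigenvalue_Q (k : Fin n) :
    ∑ l, matR m t k l * (C (legendreEigenvalue (m l)) * Q m t l)
      = C (legendreEigenvalue (m k)) * (tau m t * legendreP (m k))
        - (1 - X ^ 2) * (derivative (legendreP (m k)) * derivative (tau m t)
          - legendreP (m k) * ∑ l, C (t l) * derivative (legendreP (m l)) * Q m t l) := by
  rw [← sum_matR_mul_Q, derivative_tau]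
  simp only [Finset.mul_sum, ← Finset.sum_sub_distrib]
  refine Finset.sum_congr rfl fun l _ => ?_
  have h := wronskian_R (m k) (m l)
  rw [matR_apply]
  split_ifs with hkl
  · subst hkl; ring
  · simp only [legendreEigenvalue, map_neg, map_sub] at h ⊢
    linear_combination C (t l) * Q m t l * h

/-- Each entry of `Q m t` is an eigenfunction of `T̂(τ)`, with denominators cleared. -/
theorem Q_ode (k : Fin n) :
    (1 - X ^ 2) * (tau m t * derivative (derivative (Q m t k))
        - 2 * derivative (tau m t) * derivative (Q m t k)
        + derivative (derivative (tau m t)) * Q m t k)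
      - 2 * X * tau m t * derivative (Q m t k)
      = tau m t * (C (legendreEigenvalue (m k)) * Q m t k) := by
  refine congrFun (eq_of_sum_matR_eq m t (v := fun k => (1 - X ^ 2) * (tau m t
    * derivative (derivative (Q m t k)) - 2 * derivative (tau m t) * derivative (Q m t k)
      + derivative (derivative (tau m t)) * Q m t k) - 2 * X * tau m t * derivative (Q m t k))
    (w := fun k => tau m t * (C (legendreEigenvalue (m k)) * Q m t k)) fun k => ?_) k
  have h0 := sum_matR_mul_Q m t k
  have h1 := sum_matR_mul_derivative_Q m t k
  have h2 := sum_matR_mul_derivative_derivative_Q m t k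
  have h3 := sum_matR_mul_eigenvalue_Q m t k
  have e1 : ∑ l, matR m t k l * ((1 - X ^ 2) * (tau m t * derivative (derivative (Q m t l))
      - 2 * derivative (tau m t) * derivative (Q m t l)
      + derivative (derivative (tau m t)) * Q m t l) - 2 * X * tau m t * derivative (Q m t l))
      = (1 - X ^ 2) * tau m t * (∑ l, matR m t k l * derivative (derivative (Q m t l)))
        - ((1 - X ^ 2) * 2 * derivative (tau m t) + 2 * X * tau m t)
          * (∑ l, matR m t k l * derivative (Q m t l))
        + (1 - X ^ 2) * derivative (derivative (tau m t)) * ∑ l, matR m t k l * Q m t l := by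
    simp only [Finset.mul_sum, ← Finset.sum_sub_distrib, ← Finset.sum_add_distrib]
    exact Finset.sum_congr rfl fun l _ => by ring
  have e2 : ∑ l, matR m t k l * (tau m t * (C (legendreEigenvalue (m l)) * Q m t l))
      = tau m t * ∑ l, matR m t k l * (C (legendreEigenvalue (m l)) * Q m t l) := by
    simp only [Finset.mul_sum]
    exact Finset.sum_congr rfl fun l _ => by ring
  have h4 := legendreP_ode (m k)
  rw [← legendreEigenvalue] at h4
  rw [e1, e2, h0, h1, h2, h3]
  -- Everything cancels except `τ²` times the Legendre equation of `P_{m_k}`.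
  linear_combination tau m t ^ 2 * h4

/-! ### Adjoining an index with parameter 0 -/

theorem matR_snoc_castSucc_last (i : ℕ) (k : Fin n) :
    matR (Fin.snoc m i : Fin (n + 1) → ℕ) (Fin.snoc t 0 : Fin (n + 1) → ℝ) k.castSucc (Fin.last n)
      = 0 := by
  simp [matR_apply, (Fin.castSucc_lt_last k).ne]

theorem matR_snoc_last_last (i : ℕ) :
    matR (Fin.snoc m i : Fin (n + 1) → ℕ) (Fin.snoc t 0 : Fin (n + 1) → ℝ) (Fin.last n)
      (Fin.last n) = 1 := by
  simp [matR_apply]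

theorem matR_snoc_castSucc_castSucc (i : ℕ) (k l : Fin n) :
    matR (Fin.snoc m i : Fin (n + 1) → ℕ) (Fin.snoc t 0 : Fin (n + 1) → ℝ) k.castSucc l.castSucc
      = matR m t k l := by
  simp [matR_apply]

theorem matR_snoc_last_castSucc (i : ℕ) (l : Fin n) :
    matR (Fin.snoc m i : Fin (n + 1) → ℕ) (Fin.snoc t 0 : Fin (n + 1) → ℝ) (Fin.last n) l.castSucc
      = C (t l) * R i (m l) := by
  simp [matR_apply, (Fin.castSucc_lt_last l).ne']

/-- With parameter `0` the last column of the enlarged matrix is the last unit vector. -/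
theorem tau_snoc (i : ℕ) :
    tau (Fin.snoc m i : Fin (n + 1) → ℕ) (Fin.snoc t 0 : Fin (n + 1) → ℝ) = tau m t := by
  rw [tau, Matrix.det_succ_column _ (Fin.last n), Fin.sum_univ_castSucc]
  have h : (matR (Fin.snoc m i : Fin (n + 1) → ℕ) (Fin.snoc t 0 : Fin (n + 1) → ℝ)).submatrix
      Fin.castSucc Fin.castSucc = matR m t := by
    ext1 k l
    exact matR_snoc_castSucc_castSucc m t i k l
  simp [matR_snoc_castSucc_last, matR_snoc_last_last, Fin.succAbove_last, h, tau,
    ← two_mul, pow_mul]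

theorem Q_snoc_castSucc (i : ℕ) (k : Fin n) :
    Q (Fin.snoc m i : Fin (n + 1) → ℕ) (Fin.snoc t 0 : Fin (n + 1) → ℝ) k.castSucc = Q m t k := by
  refine congrFun (eq_of_sum_matR_eq m t (v := fun k => Q (Fin.snoc m i : Fin (n + 1) → ℕ)
    (Fin.snoc t 0 : Fin (n + 1) → ℝ) k.castSucc) fun k => ?_) k
  have h := sum_matR_mul_Q (Fin.snoc m i : Fin (n + 1) → ℕ) (Fin.snoc t 0 : Fin (n + 1) → ℝ)
    k.castSucc
  rw [Fin.sum_univ_castSucc] at h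
  simp only [matR_snoc_castSucc_last, matR_snoc_castSucc_castSucc, tau_snoc, zero_mul, add_zero,
    Fin.snoc_castSucc] at h
  rw [h, sum_matR_mul_Q]

/-- Explicit formula for `P m t i`. -/
theorem P_eq_sub_sum (i : ℕ) :
    P m t i = tau m t * legendreP i - ∑ l, C (t l) * R i (m l) * Q m t l := by
  have h := sum_matR_mul_Q (Fin.snoc m i : Fin (n + 1) → ℕ) (Fin.snoc t 0 : Fin (n + 1) → ℝ)
    (Fin.last n)
  rw [Fin.sum_univ_castSucc] at h
  simp only [matR_snoc_last_last, matR_snoc_last_castSucc, tau_snoc, one_mul,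
    Q_snoc_castSucc, Fin.snoc_last] at h
  rw [P]
  linear_combination h

theorem P_ode (i : ℕ) :
    (1 - X ^ 2) * (tau m t * derivative (derivative (P m t i))
        - 2 * derivative (tau m t) * derivative (P m t i)
        + derivative (derivative (tau m t)) * P m t i)
      - 2 * X * tau m t * derivative (P m t i)
      = tau m t * (C (legendreEigenvalue i) * P m t i) := by
  have h := Q_ode (Fin.snoc m i : Fin (n + 1) → ℕ) (Fin.snoc t 0 : Fin (n + 1) → ℝ) (Fin.last n)
  rw [tau_snoc, Fin.snoc_last] at h
  exact h

/-- The polynomial vector `τ M⁻¹ (R_{m_k j})_k`. -/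
def intQ (j : ℕ) : Fin n → ℝ[X] := (matR m t).adjugate.mulVec fun k => R (m k) j

theorem sum_matR_mul_intQ (j : ℕ) (k : Fin n) :
    ∑ l, matR m t k l * intQ m t j l = tau m t * R (m k) j :=
  sum_matR_mul_adjugate m t _ k

theorem C_mul_matR_comm (k l : Fin n) : C (t k) * matR m t k l = C (t l) * matR m t l k := by
  rw [matR_apply, matR_apply, R_comm (m l)]
  by_cases h : k = l
  · subst h; rfl
  · rw [if_neg h, if_neg (Ne.symm h)]; ring

/-- The adjugate is self-adjoint for the form `∑ t_l v_l w_l`, because `T M` is symmetric. -/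
theorem sum_mul_adjugate_comm (v w : Fin n → ℝ[X]) :
    ∑ l, C (t l) * v l * (matR m t).adjugate.mulVec w l
      = ∑ l, C (t l) * (matR m t).adjugate.mulVec v l * w l := by
  apply mul_left_cancel₀ (tau_ne_zero m t)
  set a := (matR m t).adjugate.mulVec v
  set b := (matR m t).adjugate.mulVec w
  have h1 : tau m t * ∑ l, C (t l) * v l * b l
      = ∑ l, ∑ k, C (t l) * matR m t l k * a k * b l := by
    rw [Finset.mul_sum]
    refine Finset.sum_congr rfl fun l _ => ?_
    have := sum_matR_mul_adjugate m t v l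
    calc _ = C (t l) * (tau m t * v l) * b l := by ring
      _ = _ := by
        rw [← this, Finset.mul_sum, Finset.sum_mul]
        exact Finset.sum_congr rfl fun k _ => by ring
  have h2 : tau m t * ∑ l, C (t l) * a l * w l
      = ∑ l, ∑ k, C (t l) * matR m t l k * b k * a l := by
    rw [Finset.mul_sum]
    refine Finset.sum_congr rfl fun l _ => ?_
    have := sum_matR_mul_adjugate m t w l
    calc _ = C (t l) * (tau m t * w l) * a l := by ring
      _ = _ := by
        rw [← this, Finset.mul_sum, Finset.sum_mul]
        exact Finset.sum_congr rfl fun k _ => by ring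
  rw [h1, h2, Finset.sum_comm]
  refine Finset.sum_congr rfl fun l _ => Finset.sum_congr rfl fun k _ => ?_
  rw [C_mul_matR_comm]
  ring

theorem P_eq_sub_sum_intQ (j : ℕ) :
    P m t j = tau m t * legendreP j - ∑ l, C (t l) * legendreP (m l) * intQ m t j l := by
  rw [P_eq_sub_sum, intQ, sum_mul_adjugate_comm]
  congr 1
  refine Finset.sum_congr rfl fun l _ => ?_
  rw [Q, R_comm]
  ring

/-- This is the quotient rule for `u = intQ / τ = M⁻¹ r`, where `r_k = R_{m_k j}`: `u' = M⁻¹ (p P_j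
- M' u) = M⁻¹ p (P_j - pᵀ T u)`, which is `(Q / τ)(P_{m;j} / τ)`. -/
theorem derivative_intQ (j : ℕ) (k : Fin n) :
    tau m t * derivative (intQ m t j k) - derivative (tau m t) * intQ m t j k
      = Q m t k * P m t j := by
  refine congrFun (eq_of_sum_matR_eq m t (v := fun k => tau m t * derivative (intQ m t j k)
    - derivative (tau m t) * intQ m t j k) (w := fun k => Q m t k * P m t j) fun k => ?_) k
  have h := congrArg derivative (sum_matR_mul_intQ m t j k)
  simp only [derivative_sum, derivative_mul, derivative_matR, derivative_R,
    Finset.sum_add_distrib] at h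
  have h1 : ∑ l, C (t l) * (legendreP (m k) * legendreP (m l)) * intQ m t j l
      = legendreP (m k) * (tau m t * legendreP j - P m t j) := by
    rw [P_eq_sub_sum_intQ, sub_sub_cancel, Finset.mul_sum]
    exact Finset.sum_congr rfl fun l _ => by ring
  have h2 : ∑ l, matR m t k l * (tau m t * derivative (intQ m t j l)
      - derivative (tau m t) * intQ m t j l)
      = tau m t * (∑ l, matR m t k l * derivative (intQ m t j l))
        - derivative (tau m t) * ∑ l, matR m t k l * intQ m t j l := by
    simp only [Finset.mul_sum, ← Finset.sum_sub_distrib]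
    exact Finset.sum_congr rfl fun l _ => by ring
  have h3 : ∑ l, matR m t k l * (Q m t l * P m t j)
      = (∑ l, matR m t k l * Q m t l) * P m t j := by
    rw [Finset.sum_mul]
    exact Finset.sum_congr rfl fun l _ => by ring
  rw [h2, h3, sum_matR_mul_Q, sum_matR_mul_intQ]
  rw [h1] at h
  linear_combination tau m t * h

end

/-! ### Zeros of `tau`, norms, degrees and the Sturm–Liouville problem -/

section

variable {n : ℕ} (m : Fin n → ℕ) (t : Fin n → ℝ)

/-- The numerator of `R_{ij} - ∫_{-1}^z P_{m;i} P_{m;j} τ⁻²`. -/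
theorem derivative_sum_R_mul_intQ (i j : ℕ) :
    derivative (∑ l, C (t l) * R i (m l) * intQ m t j l) * tau m t
        - (∑ l, C (t l) * R i (m l) * intQ m t j l) * derivative (tau m t)
      = tau m t ^ 2 * (legendreP i * legendreP j) - P m t i * P m t j := by
  have h1 : ∑ l, C (t l) * legendreP (m l) * intQ m t j l = tau m t * legendreP j - P m t j := by
    rw [P_eq_sub_sum_intQ, sub_sub_cancel]
  have h2 : ∑ l, C (t l) * R i (m l) * Q m t l = tau m t * legendreP i - P m t i := by
    rw [P_eq_sub_sum, sub_sub_cancel]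
  have h3 : derivative (∑ l, C (t l) * R i (m l) * intQ m t j l) * tau m t
        - (∑ l, C (t l) * R i (m l) * intQ m t j l) * derivative (tau m t)
      = tau m t * legendreP i * (∑ l, C (t l) * legendreP (m l) * intQ m t j l)
        + P m t j * ∑ l, C (t l) * R i (m l) * Q m t l := by
    simp only [derivative_sum, derivative_mul, derivative_C, derivative_R, zero_mul, zero_add,
      Finset.mul_sum, Finset.sum_mul, ← Finset.sum_sub_distrib, ← Finset.sum_add_distrib]
    refine Finset.sum_congr rfl fun l _ => ?_
    linear_combination C (t l) * R i (m l) * derivative_intQ m t j l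
  rw [h3, h1, h2]
  ring

theorem hasDerivAt_gram (i j : ℕ) {z : ℝ} (hz : (tau m t).eval z ≠ 0) :
    HasDerivAt (fun x => (R i j).eval x
        - (∑ l, C (t l) * R i (m l) * intQ m t j l).eval x / (tau m t).eval x)
      ((P m t i).eval z * (P m t j).eval z / (tau m t).eval z ^ 2) z := by
  have h := ((R i j).hasDerivAt z).sub
    (((∑ l, C (t l) * R i (m l) * intQ m t j l).hasDerivAt z).div ((tau m t).hasDerivAt z) hz)
  have h2 := congrArg (eval z) (derivative_sum_R_mul_intQ m t i j)
  simp only [eval_sub, eval_mul, eval_pow] at h2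
  rw [h2, derivative_R, eval_mul] at h
  have e : (legendreP i).eval z * (legendreP j).eval z
      - ((tau m t).eval z ^ 2 * ((legendreP i).eval z * (legendreP j).eval z)
        - (P m t i).eval z * (P m t j).eval z) / (tau m t).eval z ^ 2
      = (P m t i).eval z * (P m t j).eval z / (tau m t).eval z ^ 2 := by
    field_simp
    ring
  rw [e] at h
  exact h

/-! ### Values at 1 and the norm integrals -/

variable {m}

theorem matR_eval_one (hm : Function.Injective m) (k l : Fin n) :
    (matR m t k l).eval 1 = if k = l then 1 + t l * (2 / (2 * (m l : ℝ) + 1)) else 0 := by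
  rw [matR_apply, eval_add, eval_mul, eval_C, R_eval_one]
  by_cases h : k = l
  · subst h; simp
  · simp [h, hm.ne h]

theorem tau_eval_one (hm : Function.Injective m) :
    (tau m t).eval 1 = ∏ l, (1 + t l * (2 / (2 * (m l : ℝ) + 1))) := by
  have h : (evalRingHom (1 : ℝ)).mapMatrix (matR m t)
      = Matrix.diagonal fun l => 1 + t l * (2 / (2 * (m l : ℝ) + 1)) := by
    ext1 k l
    simp only [RingHom.mapMatrix_apply, Matrix.map_apply, coe_evalRingHom, matR_eval_one t hm,
      Matrix.diagonal_apply]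
    split_ifs with h
    · rw [h]
    · rfl
  have h2 := RingHom.map_det (evalRingHom (1 : ℝ)) (matR m t)
  rwa [h, Matrix.det_diagonal] at h2

theorem intQ_eval_one (hm : Function.Injective m) (j : ℕ) (k : Fin n) :
    (1 + t k * (2 / (2 * (m k : ℝ) + 1))) * (intQ m t j k).eval 1
      = (tau m t).eval 1 * if m k = j then 2 / (2 * (m k : ℝ) + 1) else 0 := by
  have h := congrArg (eval 1) (sum_matR_mul_intQ m t j k)
  simpa [eval_finsetSum, matR_eval_one t hm, R_eval_one] using h

/-- Only `z = 1` contributes. For `i = j = m_k` and `r = 2 / (2 m_k + 1)` the value is `r - t_k r² /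
(1 + t_k r) = r / (1 + t_k r)`. -/
theorem integral_P_mul_P (hm : Function.Injective m)
    (hτ : ∀ z ∈ Set.Icc (-1 : ℝ) 1, (tau m t).eval z ≠ 0) (i j : ℕ) :
    ∫ u in (-1 : ℝ)..1, (P m t i).eval u * (P m t j).eval u / (tau m t).eval u ^ 2
      = 2 / (1 + 2 * (i : ℝ) + 2 * ∑ l, if m l = i then t l else 0) * (if i = j then 1 else 0) := by
  have hu : Set.uIcc (-1 : ℝ) 1 = Set.Icc (-1) 1 := Set.uIcc_of_le (by norm_num)
  rw [intervalIntegral.integral_eq_sub_of_hasDerivAt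
    (f := fun x => (R i j).eval x
      - (∑ l, C (t l) * R i (m l) * intQ m t j l).eval x / (tau m t).eval x)
    (fun x hx => hasDerivAt_gram m t i j (hτ x (hu ▸ hx)))]
  · have h1 : (tau m t).eval 1 ≠ 0 := hτ 1 (by simp)
    have hl : ∀ l, 1 + t l * (2 / (2 * (m l : ℝ) + 1)) ≠ 0 := by
      intro l
      have := h1
      rw [tau_eval_one t hm, Finset.prod_ne_zero_iff] at this
      exact this l (Finset.mem_univ l)
    have hB : ∀ l, (intQ m t j l).eval 1 = (tau m t).eval 1
        * (if m l = j then 2 / (2 * (m l : ℝ) + 1) else 0)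
          / (1 + t l * (2 / (2 * (m l : ℝ) + 1))) := by
      intro l
      rw [eq_div_iff (hl l), ← intQ_eval_one t hm]
      ring
    simp only [eval_finsetSum, eval_mul, eval_C, R_eval_neg_one, mul_zero, zero_mul,
      Finset.sum_const_zero, zero_div, sub_zero, hB, R_eval_one]
    by_cases hij : i = j
    · subst hij
      simp only [if_true, mul_one]
      by_cases hi : ∃ k, m k = i
      · obtain ⟨k, rfl⟩ := hi
        have hk : ∀ l, m k = m l ↔ k = l := fun l => hm.eq_iff
        have hk' : ∀ l, m l = m k ↔ l = k := fun l => hm.eq_iff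
        have e1 : 2 * (m k : ℝ) + 1 ≠ 0 := by positivity
        have e2 : 2 * (m k : ℝ) + 1 + 2 * t k ≠ 0 := by
          intro h0
          apply hl k
          field_simp
          linear_combination h0
        have e3 : 1 + 2 * (m k : ℝ) + 2 * t k ≠ 0 := by
          intro h0; apply e2; linear_combination h0
        have e4 : 1 + t k * (2 / (2 * (m k : ℝ) + 1)) ≠ 0 := hl k
        have e5 : 1 + t k * (2 / (2 * (m k : ℝ) + 1))
          = (2 * (m k : ℝ) + 1 + 2 * t k) / (2 * (m k : ℝ) + 1) := by field_simp
        simp only [hk, hk', mul_ite, ite_mul, mul_zero, zero_mul, zero_div, ite_div,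
          Finset.sum_ite_eq', Finset.mem_univ, if_true]
        rw [e5]
        field_simp
        ring
      · have hk : ∀ l, ¬ i = m l := fun l h => hi ⟨l, h.symm⟩
        have hk' : ∀ l, ¬ m l = i := fun l h => hi ⟨l, h⟩
        simp [hk, hk']
        ring
    · simp only [hij, if_false, mul_zero, zero_sub, neg_eq_zero, div_eq_zero_iff]
      left
      refine Finset.sum_eq_zero fun l _ => ?_
      by_cases hl : m l = j
      · simp [hl, hij]
      · simp [hl]
  · apply ContinuousOn.intervalIntegrable
    rw [hu]
    exact ContinuousOn.div (by fun_prop) (by fun_prop) fun x hx => pow_ne_zero 2 (hτ x hx)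

theorem gt_of_tau_eval_ne_zero (hm : Function.Injective m)
    (hτ : ∀ z ∈ Set.Icc (-1 : ℝ) 1, (tau m t).eval z ≠ 0) (k : Fin n) :
    t k > -(m k : ℝ) - 1 / 2 := by
  have h := integral_P_mul_P t hm hτ (m k) (m k)
  have h0 : 0 ≤ ∫ u in (-1 : ℝ)..1,
      (P m t (m k)).eval u * (P m t (m k)).eval u / (tau m t).eval u ^ 2 :=
    intervalIntegral.integral_nonneg (by norm_num) fun u _ => by
      rw [← sq]; positivity
  have h1 : (tau m t).eval 1 ≠ 0 := hτ 1 (by simp)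
  rw [tau_eval_one t hm, Finset.prod_ne_zero_iff] at h1
  have h2 := h1 k (Finset.mem_univ k)
  have hs : (∑ l, if m l = m k then t l else 0) = t k := by simp [hm.eq_iff]
  rw [h, hs, if_pos rfl, mul_one] at h0
  have e1 : (0 : ℝ) < 2 * (m k : ℝ) + 1 := by positivity
  by_contra hc
  have h3 : 1 + 2 * (m k : ℝ) + 2 * t k ≤ 0 := by linarith
  -- A zero denominator makes the quotient `0` and gives no sign contradiction; that case is
  -- excluded by the `k`-th factor of `τ(1)`.
  rcases h3.lt_or_eq with h4 | h4
  · exact absurd h0 (not_le.2 (div_neg_of_pos_of_neg two_pos h4))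
  · apply h2
    field_simp
    linear_combination h4

/-! ### Bessel's inequality and the absence of zeros -/

theorem integral_sum_legendreP_mul (c : Fin n → ℝ) (g : ℝ[X]) (a b : ℝ) :
    ∫ u in a..b, (∑ k, C (c k) * legendreP (m k)).eval u * g.eval u
      = ∑ k, c k * ∫ u in a..b, (legendreP (m k)).eval u * g.eval u := by
  simp only [eval_finsetSum, eval_mul, eval_C, Finset.sum_mul, mul_assoc]
  rw [intervalIntegral.integral_finsetSum]
  · simp only [intervalIntegral.integral_const_mul]
  · intro k _
    exact Continuous.intervalIntegrable (by fun_prop) _ _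

/-- Bessel's inequality for a polynomial truncated to `[-1, z]`. -/
theorem bessel_legendreP (hm : Function.Injective m) (f : ℝ[X]) {z : ℝ}
    (hz : z ∈ Set.Icc (-1 : ℝ) 1) :
    ∑ k, ((m k : ℝ) + 1 / 2) * (∫ u in (-1 : ℝ)..z, (legendreP (m k)).eval u * f.eval u) ^ 2
      ≤ ∫ u in (-1 : ℝ)..z, f.eval u * f.eval u := by
  set a : Fin n → ℝ := fun k => ∫ u in (-1 : ℝ)..z, (legendreP (m k)).eval u * f.eval u with ha
  -- `g` is the orthogonal projection on `[-1,1]` of `f` cut off at `z`; `m_k + 1/2` is the inverse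
  -- squared norm of `P_{m_k}`. The cut-off itself is avoided by adding the nonnegative integral of
  -- `g²` over `[z,1]`.
  set c : Fin n → ℝ := fun k => ((m k : ℝ) + 1 / 2) * a k with hc
  set g : ℝ[X] := ∑ k, C (c k) * legendreP (m k) with hg
  have h1 : 0 ≤ ∫ u in (-1 : ℝ)..z, (f.eval u - g.eval u) ^ 2 :=
    intervalIntegral.integral_nonneg hz.1 fun u _ => sq_nonneg _
  have h2 : 0 ≤ ∫ u in z..1, g.eval u * g.eval u :=
    intervalIntegral.integral_nonneg hz.2 fun u _ => mul_self_nonneg _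
  have h3 : (∫ u in (-1 : ℝ)..z, g.eval u * g.eval u) + ∫ u in z..1, g.eval u * g.eval u
      = ∫ u in (-1 : ℝ)..1, g.eval u * g.eval u :=
    intervalIntegral.integral_add_adjacent_intervals
      (Continuous.intervalIntegrable (by fun_prop) _ _)
      (Continuous.intervalIntegrable (by fun_prop) _ _)
  have h4 : ∫ u in (-1 : ℝ)..z, (f.eval u - g.eval u) ^ 2
      = (∫ u in (-1 : ℝ)..z, f.eval u * f.eval u)
        - 2 * (∫ u in (-1 : ℝ)..z, g.eval u * f.eval u)
        + ∫ u in (-1 : ℝ)..z, g.eval u * g.eval u := by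
    rw [← intervalIntegral.integral_const_mul, ← intervalIntegral.integral_sub,
      ← intervalIntegral.integral_add]
    · congr 1; ext u; ring
    all_goals exact Continuous.intervalIntegrable (by fun_prop) _ _
  have h5 : ∫ u in (-1 : ℝ)..z, g.eval u * f.eval u = ∑ k, ((m k : ℝ) + 1 / 2) * a k ^ 2 := by
    rw [hg, integral_sum_legendreP_mul]
    exact Finset.sum_congr rfl fun k _ => by simp only [hc, ha]; ring
  have h6 : ∫ u in (-1 : ℝ)..1, g.eval u * g.eval u = ∑ k, ((m k : ℝ) + 1 / 2) * a k ^ 2 := by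
    rw [hg, integral_sum_legendreP_mul]
    refine Finset.sum_congr rfl fun k _ => ?_
    have : ∫ u in (-1 : ℝ)..1, (legendreP (m k)).eval u * (∑ l, C (c l) * legendreP (m l)).eval u
        = c k * (2 / (2 * (m k : ℝ) + 1)) := by
      simp_rw [mul_comm (eval _ (legendreP (m k)))]
      rw [integral_sum_legendreP_mul]
      simp only [← eval_R, R_eval_one, hm.eq_iff]
      simp
    rw [this, hc]
    have e1 : 2 * (m k : ℝ) + 1 ≠ 0 := by positivity
    field_simp
  rw [h4, h5] at h1
  rw [h6] at h3
  linarith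

/-- For `M(z) v = 0` and `f = ∑ t_l v_l P_{m_l}`, the integrals over `[-1,z]` are `∫ P_{m_k} f =
-v_k` and `∫ f² = -∑ t_l v_l²`. Bessel then gives `∑ (m_k + 1/2 + t_k) v_k² ≤ 0`. -/
theorem tau_eval_ne_zero (hm : Function.Injective m) (ht : ∀ k, t k > -(m k : ℝ) - 1 / 2)
    {z : ℝ} (hz : z ∈ Set.Icc (-1 : ℝ) 1) : (tau m t).eval z ≠ 0 := by
  intro h0
  have hdet : ((evalRingHom z).mapMatrix (matR m t)).det = 0 := by
    rw [← RingHom.map_det]; exact h0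
  obtain ⟨v, hv, hMv⟩ := Matrix.exists_mulVec_eq_zero_iff.2 hdet
  set f : ℝ[X] := ∑ l, C (t l * v l) * legendreP (m l) with hf
  have ha : ∀ k, ∫ u in (-1 : ℝ)..z, (legendreP (m k)).eval u * f.eval u = -v k := by
    intro k
    have h := congrFun hMv k
    simp only [Matrix.mulVec, dotProduct, RingHom.mapMatrix_apply, Matrix.map_apply,
      coe_evalRingHom, matR_apply, eval_add, eval_mul, eval_C, apply_ite (eval z), eval_one,
      eval_zero, add_mul, ite_mul, one_mul, zero_mul, Finset.sum_add_distrib, Finset.sum_ite_eq,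
      Finset.mem_univ, if_true, Pi.zero_apply] at h
    simp_rw [mul_comm (eval _ (legendreP (m k)))]
    rw [hf, integral_sum_legendreP_mul]
    simp only [← eval_R]
    rw [eq_neg_iff_add_eq_zero, add_comm, ← h]
    congr 1
    exact Finset.sum_congr rfl fun l _ => by rw [R_comm]; ring
  have hff : ∫ u in (-1 : ℝ)..z, f.eval u * f.eval u = -∑ l, t l * v l ^ 2 := by
    conv_lhs => enter [1, u, 1]; rw [hf]
    rw [integral_sum_legendreP_mul]
    simp only [ha]
    rw [← Finset.sum_neg_distrib]
    exact Finset.sum_congr rfl fun l _ => by ring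
  have hb := bessel_legendreP hm f hz
  simp only [ha, hff] at hb
  have hpos : 0 < ∑ k, ((m k : ℝ) + 1 / 2 + t k) * v k ^ 2 := by
    obtain ⟨k, hk⟩ := Function.ne_iff.1 hv
    refine Finset.sum_pos' (fun l _ => ?_) ⟨k, Finset.mem_univ k, ?_⟩
    · exact mul_nonneg (by linarith [ht l]) (sq_nonneg _)
    · have : v k ≠ 0 := hk
      exact mul_pos (by linarith [ht k]) (by positivity)
  simp only [add_mul _ (t _), Finset.sum_add_distrib] at hpos
  simp only [neg_sq] at hb
  linarith

theorem P_ne_zero (hm : Function.Injective m) (ht : ∀ k, t k > -(m k : ℝ) - 1 / 2) (i : ℕ) :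
    P m t i ≠ 0 := by
  intro h0
  have h := integral_P_mul_P t hm (fun z hz => tau_eval_ne_zero t hm ht hz) i i
  simp only [h0, eval_zero, zero_mul, zero_div, intervalIntegral.integral_zero, if_true,
    mul_one] at h
  have hd : 0 < 1 + 2 * (i : ℝ) + 2 * ∑ l, if m l = i then t l else 0 := by
    by_cases hi : ∃ k, m k = i
    · obtain ⟨k, rfl⟩ := hi
      have hs : (∑ l, if m l = m k then t l else 0) = t k := by simp [hm.eq_iff]
      rw [hs]
      linarith [ht k]
    · have hk' : ∀ l, ¬ m l = i := fun l h => hi ⟨l, h⟩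
      simp only [hk', if_false, Finset.sum_const_zero]
      positivity
  have : 0 < 2 / (1 + 2 * (i : ℝ) + 2 * ∑ l, if m l = i then t l else 0) := by positivity
  linarith

/-! ### Degrees and the eigenvalue problem -/

variable (m)

theorem natDegree_P (i : ℕ) (hP : P m t i ≠ 0) (hi : (tau m t).natDegree ≤ i) :
    (P m t i).natDegree = (tau m t).natDegree + i := by
  set τ := tau m t with hτ
  set q := P m t i with hq
  set N := τ.natDegree with hN
  set d := q.natDegree with hd
  have b1 : ∀ p : ℝ[X], (X * derivative p).natDegree ≤ p.natDegree := by
    intro p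
    by_cases h : p.natDegree = 0
    · simp [derivative_of_natDegree_zero h]
    · refine natDegree_mul_le.trans ?_
      have := natDegree_derivative_le p
      rw [natDegree_X]
      omega
  have b2 : ∀ p : ℝ[X], (X ^ 2 * derivative (derivative p)).natDegree ≤ p.natDegree := by
    intro p
    have h1 := natDegree_derivative_le p
    have h2 := natDegree_derivative_le (derivative p)
    by_cases h : (derivative p).natDegree = 0
    · simp [derivative_of_natDegree_zero h]
    · refine natDegree_mul_le.trans ?_
      rw [natDegree_X_pow]
      omega
  have c1 : ∀ p : ℝ[X], ∀ k, (X * derivative p).coeff k = k * p.coeff k := by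
    intro p k
    cases k with
    | zero => simp
    | succ k => rw [coeff_X_mul, coeff_derivative]; push_cast; ring
  have c2 : ∀ p : ℝ[X], ∀ k, (X ^ 2 * derivative (derivative p)).coeff k
      = k * (k - 1) * p.coeff k := by
    intro p k
    have : X ^ 2 * derivative (derivative p)
        = X * derivative (X * derivative p) - X * derivative p := by
      rw [derivative_mul, derivative_X]; ring
    rw [this, coeff_sub, c1, c1]
    ring
  -- Multiplying the equation by `X²` pairs each derivative with a power of `X`, so coefficients are
  -- only rescaled and degrees do not grow.
  set A := τ * (X ^ 2 * derivative (derivative q)) - 2 * ((X * derivative τ) * (X * derivative q))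
    + (X ^ 2 * derivative (derivative τ)) * q with hA
  have hAdeg : A.natDegree ≤ N + d := by
    refine (natDegree_add_le _ _).trans (max_le ((natDegree_sub_le _ _).trans (max_le ?_ ?_)) ?_)
    · exact natDegree_mul_le.trans (add_le_add le_rfl (b2 q))
    · have : (2 : ℝ[X]) = C 2 := (map_ofNat C 2).symm
      rw [this]
      exact (natDegree_C_mul_le _ _).trans
        (natDegree_mul_le.trans (add_le_add (b1 τ) (b1 q)))
    · exact natDegree_mul_le.trans (add_le_add (b2 τ) le_rfl)
  have hode : A - X ^ 2 * A - 2 * (X ^ 2 * (τ * (X * derivative q)))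
      = C (legendreEigenvalue i) * (X ^ 2 * (τ * q)) := by
    have := P_ode m t i
    rw [← hτ, ← hq] at this
    rw [hA]
    linear_combination X ^ 2 * this
  have hc := congrArg (fun p => coeff p (N + d + 2)) hode
  have h2 : (2 : ℝ[X]) = C 2 := (map_ofNat C 2).symm
  have hA0 : A.coeff (N + d + 2) = 0 := coeff_eq_zero_of_natDegree_lt (by omega)
  simp only [coeff_sub, h2, coeff_C_mul, coeff_X_pow_mul, hA0] at hc
  have hAc : A.coeff (N + d) = (d * (d - 1) - 2 * (N * d) + N * (N - 1))
      * (τ.coeff N * q.coeff d) := by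
    rw [hA, h2, coeff_add, coeff_sub, coeff_C_mul, coeff_mul_add_eq_of_natDegree_le le_rfl (b2 q),
      coeff_mul_add_eq_of_natDegree_le (b1 τ) (b1 q), coeff_mul_add_eq_of_natDegree_le (b2 τ) le_rfl,
      c2, c2, c1, c1]
    ring
  rw [hAc, coeff_mul_add_eq_of_natDegree_le le_rfl (b1 q), coeff_mul_add_eq_of_natDegree_le le_rfl le_rfl,
    c1] at hc
  have hne : τ.coeff N * q.coeff d ≠ 0 :=
    mul_ne_zero (leadingCoeff_ne_zero.2 (tau_ne_zero m t)) (leadingCoeff_ne_zero.2 hP)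
  have hfac : ((d : ℝ) - N - i) * (d - N + i + 1) = 0 := by
    apply mul_right_cancel₀ hne
    rw [legendreEigenvalue] at hc
    linear_combination -hc
  -- The other root `d = N - i - 1` is impossible for `N ≤ i`.
  rcases mul_eq_zero.1 hfac with h | h
  · have : (d : ℝ) = N + i := by linear_combination h
    exact_mod_cast this
  · have : (d : ℝ) + i + 1 = N := by linear_combination h
    have : d + i + 1 = N := by exact_mod_cast this
    omega

theorem excOp_P (i : ℕ) {z : ℝ} (hz : (tau m t).eval z ≠ 0) :
    excOp (tau m t) (P m t i) z = legendreEigenvalue i * (P m t i).eval z := by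
  have h := congrArg (eval z) (P_ode m t i)
  simp only [eval_sub, eval_add, eval_mul, eval_pow, eval_X, eval_one, eval_C, eval_ofNat] at h
  apply mul_left_cancel₀ hz
  rw [← h, excOp]
  field_simp

theorem isSturmLiouvilleEigenfunction_P (hτ : ∀ z ∈ Set.Icc (-1 : ℝ) 1, (tau m t).eval z ≠ 0)
    (i : ℕ) (hP : P m t i ≠ 0) :
    IsSturmLiouvilleEigenfunction (-1) 1 (slP (tau m t)) (slQ (tau m t)) (weight (tau m t))
      (legendreEigenvalue i) (fun z => (P m t i).eval z) := by
  have hd : deriv (fun z => (P m t i).eval z) = fun z => (derivative (P m t i)).eval z := by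
    ext z; exact (P m t i).deriv
  have hc : ∀ z ∈ Set.Icc (-1 : ℝ) 1,
      DifferentiableAt ℝ (fun x => slP (tau m t) x * (derivative (P m t i)).eval x) z := by
    intro z hz
    have := hτ z hz
    unfold slP
    have h1 : DifferentiableAt ℝ (fun x : ℝ => (1 - x ^ 2)) z := by fun_prop
    have h2 : DifferentiableAt ℝ (fun x : ℝ => (tau m t).eval x ^ 2) z := by fun_prop
    exact (h1.div h2 (pow_ne_zero 2 this)).mul (by fun_prop)
  refine ⟨?_, fun z _ => by fun_prop, fun z hz => ?_, fun z hz => ?_, ?_, ?_⟩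
  · by_contra! h
    apply hP
    apply Polynomial.eq_zero_of_infinite_isRoot
    exact (Set.Ioo_infinite (by norm_num : (-1 : ℝ) < 1)).mono fun z hz => h z hz
  · rw [hd]; exact hc z (Set.Ioo_subset_Icc_self hz)
  · have := hτ z (Set.Ioo_subset_Icc_self hz)
    rw [sturmLiouville_form _ _ _ this, excOp_P m t i this]
    ring
  · rw [hd]
    have h := (hc (-1) (by simp)).continuousAt.tendsto
    simp only [slP] at h ⊢
    norm_num at h
    exact h.mono_left nhdsWithin_le_nhds
  · rw [hd]
    have h := (hc 1 (by simp)).continuousAt.tendsto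
    simp only [slP] at h ⊢
    norm_num at h
    exact h.mono_left nhdsWithin_le_nhds

end

/-! ### Completeness -/

section

theorem ae_weightMeasure_mem_Icc (τ : ℝ[X]) :
    ∀ᵐ z ∂weightMeasure τ, z ∈ Set.Icc (-1 : ℝ) 1 :=
  (withDensity_absolutelyContinuous _ _).ae_le (ae_restrict_mem measurableSet_Icc)

theorem isFiniteMeasure_weightMeasure {τ : ℝ[X]}
    (hτ : ∀ z ∈ Set.Icc (-1 : ℝ) 1, τ.eval z ≠ 0) : IsFiniteMeasure (weightMeasure τ) := by
  refine isFiniteMeasure_withDensity_ofReal ?_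
  have : ContinuousOn (weight τ) (Set.Icc (-1) 1) :=
    ContinuousOn.div (by fun_prop) (by fun_prop) fun x hx => pow_ne_zero 2 (hτ x hx)
  exact (this.integrableOn_compact isCompact_Icc).hasFiniteIntegral

theorem exists_bound_eval (p : ℝ[X]) :
    ∃ c : ℝ, 0 ≤ c ∧ ∀ z ∈ Set.Icc (-1 : ℝ) 1, |p.eval z| ≤ c := by
  obtain ⟨c, hc⟩ := (isCompact_Icc (a := (-1 : ℝ)) (b := 1)).exists_bound_of_continuousOn
    (f := fun z => p.eval z) (by fun_prop)
  exact ⟨c, (norm_nonneg _).trans (hc 1 (by simp)), hc⟩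

theorem memLp_eval {τ : ℝ[X]} (hτ : ∀ z ∈ Set.Icc (-1 : ℝ) 1, τ.eval z ≠ 0) (p : ℝ[X]) :
    MemLp (fun z => p.eval z) 2 (weightMeasure τ) := by
  have := isFiniteMeasure_weightMeasure hτ
  obtain ⟨c, -, hc⟩ := exists_bound_eval p
  refine MemLp.of_bound (Continuous.aestronglyMeasurable (by fun_prop)) c ?_
  filter_upwards [ae_weightMeasure_mem_Icc τ] with z hz
  exact hc z hz

/-- Polynomials as elements of `L²([-1,1], τ⁻² dz)`. -/
def evalToLp {τ : ℝ[X]} (hτ : ∀ z ∈ Set.Icc (-1 : ℝ) 1, τ.eval z ≠ 0) :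
    ℝ[X] →ₗ[ℝ] Lp ℝ 2 (weightMeasure τ) where
  toFun p := (memLp_eval hτ p).toLp _
  map_add' p q := by
    rw [← MemLp.toLp_add]
    congr 1
    ext z
    simp
  map_smul' c p := by
    rw [RingHom.id_apply, ← MemLp.toLp_const_smul]
    congr 1
    ext z
    simp

/-- A set of polynomials whose span is uniformly dense in `C([-1,1])` is complete in `L²`. -/
theorem span_evalToLp_topologicalClosure {τ : ℝ[X]}
    (hτ : ∀ z ∈ Set.Icc (-1 : ℝ) 1, τ.eval z ≠ 0) (s : Set ℝ[X])
    (hs : ∀ f : ℝ → ℝ, Continuous f → ∀ ε > 0, ∃ h ∈ Submodule.span ℝ s,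
      ∀ z ∈ Set.Icc (-1 : ℝ) 1, |h.eval z - f z| ≤ ε) :
    (Submodule.span ℝ (evalToLp hτ '' s)).topologicalClosure = ⊤ := by
  have := isFiniteMeasure_weightMeasure hτ
  set S := Submodule.span ℝ (evalToLp hτ '' s) with hS
  have hd := BoundedContinuousFunction.toLp_denseRange (E := ℝ) (weightMeasure τ) ℝ
    (p := 2) (by norm_num)
  rw [Submodule.eq_top_iff']
  intro φ
  have hsub : Set.range (BoundedContinuousFunction.toLp (E := ℝ) 2 (weightMeasure τ) ℝ)
      ⊆ (S.topologicalClosure : Set (Lp ℝ 2 (weightMeasure τ))) := by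
    rintro _ ⟨f, rfl⟩
    rw [Submodule.topologicalClosure_coe]
    refine Metric.mem_closure_iff.2 fun ε hε => ?_
    -- `K` is the square root of the total mass, which bounds the `L²` norm by the sup norm.
    set K : ℝ := (measureUnivNNReal (weightMeasure τ) : ℝ) ^ ((2 : ENNReal).toReal⁻¹) with hK
    have hK0 : 0 ≤ K := by positivity
    obtain ⟨h, hh, hb⟩ := hs f f.continuous (ε / (2 * (K + 1))) (by positivity)
    refine ⟨evalToLp hτ h, ?_, ?_⟩
    · rw [hS, ← Submodule.map_span]
      exact Submodule.mem_map_of_mem hh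
    · rw [dist_eq_norm, norm_sub_rev]
      refine lt_of_le_of_lt (Lp.norm_le_of_ae_bound (C := ε / (2 * (K + 1))) (by positivity) ?_) ?_
      · filter_upwards [ae_weightMeasure_mem_Icc τ,
          Lp.coeFn_sub (evalToLp hτ h)
            (BoundedContinuousFunction.toLp (E := ℝ) 2 (weightMeasure τ) ℝ f),
          MemLp.coeFn_toLp (memLp_eval hτ h),
          BoundedContinuousFunction.coeFn_toLp 2 (weightMeasure τ) ℝ f] with z h1 h2 h3 h4
        rw [h2, Pi.sub_apply, h4]
        have h5 : (evalToLp hτ h) z = h.eval z := h3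
        rw [h5]
        exact hb z h1
      · have e : K * (ε / (2 * (K + 1))) ≤ ε / 2 := by
          rw [mul_div_assoc', div_le_div_iff₀ (by positivity) (by positivity)]
          nlinarith
        change K * (ε / (2 * (K + 1))) < ε
        linarith
  exact closure_minimal hsub (Submodule.isClosed_topologicalClosure S) (hd φ)

/-! ### The transformation taking classical to exceptional polynomials -/

variable {n : ℕ} (m : Fin n → ℕ) (t : Fin n → ℝ)

/-- By `P_eq_sub_sum` the transformation takes `P_i` to `P_{m;i}`; linearity extends this to every
polynomial. -/
theorem exists_mem_span_P_eval (G : ℝ[X]) :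
    ∃ h ∈ Submodule.span ℝ (Set.range (P m t)), ∀ z : ℝ, h.eval z = (tau m t).eval z * G.eval z
      - ∑ l, t l * (Q m t l).eval z * ∫ u in (-1 : ℝ)..z, (legendreP (m l)).eval u * G.eval u := by
  have hG : G ∈ Submodule.span ℝ (Set.range legendreP) :=
    Submodule.span_mono (Set.image_subset_range _ _)
      (mem_span_legendreP (G.natDegree + 1) G (Nat.lt_succ_self _))
  induction hG using Submodule.span_induction with
  | mem x hx =>
    obtain ⟨i, rfl⟩ := hx
    refine ⟨P m t i, Submodule.subset_span ⟨i, rfl⟩, fun z => ?_⟩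
    rw [P_eq_sub_sum]
    simp only [eval_sub, eval_mul, eval_finsetSum, eval_C, ← eval_R]
    congr 1
    exact Finset.sum_congr rfl fun l _ => by rw [R_comm]; ring
  | zero => exact ⟨0, Submodule.zero_mem _, fun z => by simp⟩
  | add x y _ _ hx hy =>
    obtain ⟨a, ha, hae⟩ := hx
    obtain ⟨b, hb, hbe⟩ := hy
    refine ⟨a + b, Submodule.add_mem _ ha hb, fun z => ?_⟩
    rw [eval_add, hae, hbe, eval_add]
    have : ∀ l, ∫ u in (-1 : ℝ)..z, (legendreP (m l)).eval u * (x + y).eval u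
        = (∫ u in (-1 : ℝ)..z, (legendreP (m l)).eval u * x.eval u)
          + ∫ u in (-1 : ℝ)..z, (legendreP (m l)).eval u * y.eval u := by
      intro l
      rw [← intervalIntegral.integral_add (Continuous.intervalIntegrable (by fun_prop) _ _)
        (Continuous.intervalIntegrable (by fun_prop) _ _)]
      simp only [eval_add, mul_add]
    simp only [this, mul_add, Finset.sum_add_distrib]
    ring
  | smul c x _ hx =>
    obtain ⟨a, ha, hae⟩ := hx
    refine ⟨c • a, Submodule.smul_mem _ c ha, fun z => ?_⟩
    rw [eval_smul, hae, eval_smul]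
    simp only [eval_smul, smul_eq_mul, mul_left_comm _ c, intervalIntegral.integral_const_mul]
    rw [← Finset.mul_sum]
    ring

/-- Every continuous function on `[-1,1]` is in the range of the transformation
`g ↦ τ g - ∑ t_l Q_l ∫_{-1}^z P_{m_l} g`. -/
theorem exists_continuous_preimage (hτ : ∀ z ∈ Set.Icc (-1 : ℝ) 1, (tau m t).eval z ≠ 0)
    (f : ℝ → ℝ) (hf : Continuous f) :
    ∃ g : ℝ → ℝ, Continuous g ∧ ∀ z ∈ Set.Icc (-1 : ℝ) 1, f z = (tau m t).eval z * g z
      - ∑ l, t l * (Q m t l).eval z * ∫ u in (-1 : ℝ)..z, (legendreP (m l)).eval u * g u := by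
  -- Clamping to `[-1,1]` makes the quotients by `τ` continuous on the whole line.
  set c : ℝ → ℝ := fun z => max (-1) (min 1 z) with hc
  have hcc : Continuous c := by fun_prop
  have hcm : ∀ z, c z ∈ Set.Icc (-1 : ℝ) 1 := fun z => ⟨le_max_left _ _, by simp [hc]⟩
  have hce : ∀ z ∈ Set.Icc (-1 : ℝ) 1, c z = z := fun z hz => by simp [hc, hz.1, hz.2]
  set y : ℝ → ℝ := fun z => f (c z) / (tau m t).eval (c z) with hy
  have hyc : Continuous y := Continuous.div (by fun_prop) (by fun_prop) fun z => hτ _ (hcm z)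
  set φ : Fin n → ℝ → ℝ := fun l z => (Q m t l).eval z / (tau m t).eval (c z) * y z with hφ
  have hφc : ∀ l, Continuous (φ l) := fun l =>
    (Continuous.div (by fun_prop) (by fun_prop) fun z => hτ _ (hcm z)).mul hyc
  set b : Fin n → ℝ → ℝ := fun l z => ∫ u in (-1 : ℝ)..z, φ l u with hb
  have hbd : ∀ l z, HasDerivAt (b l) (φ l z) z := fun l z =>
    ((hφc l).integral_hasStrictDerivAt (-1) z).hasDerivAt
  have hbc : ∀ l, Continuous (b l) := fun l =>
    continuous_iff_continuousAt.2 fun z => (hbd l z).continuousAt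
  -- The explicit inverse. Since `b' = φ = (Q / τ) y`, one has `(M b)' = p pᵀ T b + p y = p g`, so
  -- `M b` is the vector of integrals `∫ P_{m_k} g`.
  set g : ℝ → ℝ := fun z => y z + ∑ l, t l * (legendreP (m l)).eval z * b l z with hg
  have hgc : Continuous g := by fun_prop
  have hint : ∀ k, ∀ z ∈ Set.Icc (-1 : ℝ) 1,
      ∫ u in (-1 : ℝ)..z, (legendreP (m k)).eval u * g u
        = ∑ l, (matR m t k l).eval z * b l z := by
    intro k z hz
    rw [intervalIntegral.integral_eq_sub_of_hasDerivAt
      (f := fun x => ∑ l, (matR m t k l).eval x * b l x)]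
    · simp [hb]
    · intro x hx
      rw [Set.uIcc_of_le hz.1] at hx
      have hx' : x ∈ Set.Icc (-1 : ℝ) 1 := ⟨hx.1, hx.2.trans hz.2⟩
      have h1 := HasDerivAt.fun_sum (u := Finset.univ)
        fun l _ => ((matR m t k l).hasDerivAt x).mul (hbd l x)
      have h2 := congrArg (eval x) (sum_matR_mul_Q m t k)
      simp only [eval_finsetSum, eval_mul] at h2
      have h3 := hτ x hx'
      have e : ∑ l, ((derivative (matR m t k l)).eval x * b l x + (matR m t k l).eval x * φ l x)
          = (legendreP (m k)).eval x * g x := by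
        have e1 : ∑ l, (matR m t k l).eval x * φ l x = (legendreP (m k)).eval x * y x := by
          have : ∑ l, (matR m t k l).eval x * φ l x
              = (∑ l, (matR m t k l).eval x * (Q m t l).eval x) * (y x / (tau m t).eval x) := by
            rw [Finset.sum_mul]
            refine Finset.sum_congr rfl fun l _ => ?_
            simp only [hφ, hce x hx']
            ring
          rw [this, h2]
          field_simp
        rw [Finset.sum_add_distrib, e1, hg, mul_add, Finset.mul_sum, add_comm]
        congr 1
        refine Finset.sum_congr rfl fun l _ => ?_
        rw [derivative_matR, eval_mul, eval_mul, eval_C]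
        ring
      rw [← e]
      exact h1
    · exact Continuous.intervalIntegrable (by fun_prop) _ _
  refine ⟨g, hgc, fun z hz => ?_⟩
  have h0 := hτ z hz
  have hyz : (tau m t).eval z * y z = f z := by
    simp only [hy, hce z hz]
    field_simp
  -- Symmetry of `T M` gives `Qᵀ T M = (M Q)ᵀ T = τ pᵀ T`.
  have hsum : ∑ l, t l * (Q m t l).eval z * ∑ k, (matR m t l k).eval z * b k z
      = (tau m t).eval z * ∑ l, t l * (legendreP (m l)).eval z * b l z := by
    simp only [Finset.mul_sum]
    rw [Finset.sum_comm]
    refine Finset.sum_congr rfl fun k _ => ?_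
    have h2 := congrArg (eval z) (sum_matR_mul_Q m t k)
    simp only [eval_finsetSum, eval_mul] at h2
    calc _ = t k * b k z * ∑ l, (matR m t k l).eval z * (Q m t l).eval z := by
          rw [Finset.mul_sum]
          refine Finset.sum_congr rfl fun l _ => ?_
          have h3 := congrArg (eval z) (C_mul_matR_comm m t k l)
          simp only [eval_mul, eval_C] at h3
          linear_combination (-(Q m t l).eval z * b k z) * h3
      _ = _ := by rw [h2]; ring
  rw [Finset.sum_congr rfl fun l _ => by rw [hint l z hz], hsum]
  simp only [hg]
  linear_combination -hyz

theorem exists_mem_span_P_near (hτ : ∀ z ∈ Set.Icc (-1 : ℝ) 1, (tau m t).eval z ≠ 0)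
    (f : ℝ → ℝ) (hf : Continuous f) (ε : ℝ) (hε : 0 < ε) :
    ∃ h ∈ Submodule.span ℝ (Set.range (P m t)),
      ∀ z ∈ Set.Icc (-1 : ℝ) 1, |h.eval z - f z| ≤ ε := by
  obtain ⟨g, hg, hfg⟩ := exists_continuous_preimage m t hτ f hf
  obtain ⟨A, hA0, hA⟩ := exists_bound_eval (tau m t)
  choose B hB0 hB using fun l => exists_bound_eval (Q m t l)
  choose D hD0 hD using fun l => exists_bound_eval (legendreP (m l))
  -- A sup-norm bound for the transformation; the `2` is the length of `[-1,1]`.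
  set K : ℝ := A + ∑ l, |t l| * B l * (D l * 2) with hK
  have hK0 : 0 ≤ K := add_nonneg hA0 (Finset.sum_nonneg fun l _ =>
    mul_nonneg (mul_nonneg (abs_nonneg _) (hB0 l)) (mul_nonneg (hD0 l) zero_le_two))
  set δ := ε / (K + 1) with hδ
  have hδ0 : 0 < δ := by positivity
  obtain ⟨G, hG⟩ := exists_polynomial_near_of_continuousOn (-1) 1 g hg.continuousOn δ hδ0
  obtain ⟨h, hh, hhe⟩ := exists_mem_span_P_eval m t G
  refine ⟨h, hh, fun z hz => ?_⟩
  have hI : ∀ l, |∫ u in (-1 : ℝ)..z, (legendreP (m l)).eval u * (G.eval u - g u)|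
      ≤ D l * δ * 2 := by
    intro l
    refine (intervalIntegral.norm_integral_le_of_norm_le_const (C := D l * δ)
      (f := fun u => (legendreP (m l)).eval u * (G.eval u - g u)) fun u hu => ?_).trans ?_
    · rw [Set.uIoc_of_le hz.1] at hu
      have hu' : u ∈ Set.Icc (-1 : ℝ) 1 := ⟨hu.1.le, hu.2.trans hz.2⟩
      rw [norm_mul]
      exact mul_le_mul (hD l u hu') (hG u hu').le (norm_nonneg _) (hD0 l)
    · have := hD0 l
      refine mul_le_mul_of_nonneg_left ?_ (by positivity)
      rw [abs_of_nonneg (by linarith [hz.1])]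
      linarith [hz.2]
  have hdiff : h.eval z - f z = (tau m t).eval z * (G.eval z - g z)
      - ∑ l, t l * (Q m t l).eval z
        * ∫ u in (-1 : ℝ)..z, (legendreP (m l)).eval u * (G.eval u - g u) := by
    rw [hhe, hfg z hz]
    have : ∀ l, ∫ u in (-1 : ℝ)..z, (legendreP (m l)).eval u * (G.eval u - g u)
        = (∫ u in (-1 : ℝ)..z, (legendreP (m l)).eval u * G.eval u)
          - ∫ u in (-1 : ℝ)..z, (legendreP (m l)).eval u * g u := by
      intro l
      rw [← intervalIntegral.integral_sub (Continuous.intervalIntegrable (by fun_prop) _ _)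
        (Continuous.intervalIntegrable (by fun_prop) _ _)]
      simp only [mul_sub]
    simp only [this]
    simp only [mul_sub, Finset.sum_sub_distrib]
    ring
  have h1 : |(tau m t).eval z * (G.eval z - g z)| ≤ A * δ := by
    rw [abs_mul]
    exact mul_le_mul (hA z hz) (hG z hz).le (abs_nonneg _) hA0
  have h2 : |∑ l, t l * (Q m t l).eval z
      * ∫ u in (-1 : ℝ)..z, (legendreP (m l)).eval u * (G.eval u - g u)|
      ≤ ∑ l, |t l| * B l * (D l * δ * 2) := by
    refine (Finset.abs_sum_le_sum_abs _ _).trans (Finset.sum_le_sum fun l _ => ?_)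
    rw [abs_mul, abs_mul]
    exact mul_le_mul (mul_le_mul_of_nonneg_left (hB l z hz) (abs_nonneg _)) (hI l) (abs_nonneg _)
      (mul_nonneg (abs_nonneg _) (hB0 l))
  have h3 : A * δ + ∑ l, |t l| * B l * (D l * δ * 2) = K * δ := by
    rw [hK, add_mul, Finset.sum_mul]
    congr 1
    exact Finset.sum_congr rfl fun l _ => by ring
  have h4 : K * δ ≤ ε := by
    rw [hδ, mul_div_assoc', div_le_iff₀ (by positivity)]
    nlinarith
  rw [hdiff]
  exact (abs_sub _ _).trans (by linarith)

variable {m}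

theorem isExceptionalLegendreFamily_P (hm : Function.Injective m)
    (ht : ∀ k, t k > -(m k : ℝ) - 1 / 2) :
    IsExceptionalLegendreFamily (tau m t) (P m t) := by
  have hτ : ∀ z ∈ Set.Icc (-1 : ℝ) 1, (tau m t).eval z ≠ 0 :=
    fun z hz => tau_eval_ne_zero t hm ht hz
  refine ⟨hτ, ⟨legendreEigenvalue, fun i =>
    isSturmLiouvilleEigenfunction_P m t hτ i (P_ne_zero t hm ht i)⟩, ?_, fun i j hij => ?_,
    fun i => memLp_eval hτ _, ?_⟩
  · refine (Set.finite_Iio (2 * (tau m t).natDegree)).subset fun d hd => ?_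
    by_contra hlt
    rw [Set.mem_Iio, not_lt] at hlt
    apply hd.2 (d - (tau m t).natDegree)
    rw [natDegree_P m t _ (P_ne_zero t hm ht _) (by omega)]
    omega
  · rw [integral_P_mul_P t hm hτ, if_neg hij, mul_zero]
  · have h := span_evalToLp_topologicalClosure hτ (Set.range (P m t))
      fun f hf ε hε => exists_mem_span_P_near m t hτ f hf ε hε
    rw [← Set.range_comp] at h
    exact h

end

end ExcLegendre

end

theorem mainTheorem2 (n : ℕ) (m : Fin n → ℕ) (hm : Function.Injective m) (t : Fin n → ℝ) :
    ((∀ z ∈ Set.Icc (-1 : ℝ) 1, (ExcLegendre.tau m t).eval z ≠ 0) ↔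
      ∀ j, t j > -(m j : ℝ) - 1 / 2) ∧
    ((∀ j, t j > -(m j : ℝ) - 1 / 2) →
      ExcLegendre.IsExceptionalLegendreFamily (ExcLegendre.tau m t) (ExcLegendre.P m t) ∧
      ∀ i₁ i₂ : ℕ,
        ∫ u in (-1 : ℝ)..1,
            (ExcLegendre.P m t i₁).eval u * (ExcLegendre.P m t i₂).eval u
              / (ExcLegendre.tau m t).eval u ^ 2
          = 2 / (1 + 2 * (i₁ : ℝ) + 2 * ∑ j, if m j = i₁ then t j else 0)
              * (if i₁ = i₂ then 1 else 0)) := by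
  refine ⟨⟨fun h j => ExcLegendre.gt_of_tau_eval_ne_zero t hm h j,
    fun h z hz => ExcLegendre.tau_eval_ne_zero t hm h hz⟩, fun h =>
    ⟨ExcLegendre.isExceptionalLegendreFamily_P t hm h, fun i j => ?_⟩⟩
  exact ExcLegendre.integral_P_mul_P t hm (fun z hz => ExcLegendre.tau_eval_ne_zero t hm h hz) i j
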